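/- Let $G$ be a finite graph (loops and multiple edges allowed) cellularly embedded in a connected closed surface $\Sigma$, equivalently a connected ribbon graph, and let $G^*$ be its geometric dual, with $E(G^*)$ identified with $E(G)$. For a graph $H$ and $A\subseteq E(H)$ let $c_H(A)$ be the number of connected components of the spanning subgraph $(V(H),A)$, $r_H(A)=|V(H)|-c_H(A)$ and $n_H(A)=|A|-r_H(A)$; let $f_G(A)$ be the number of boundary components of the spanning ribbon subgraph $(V(G),A)$ of $G$. Let $C(H)$ be the cycle matroid of $H$, with rank function $r_H$, and $B(H)=C(H)^*$ its bond matroid. Writing $E=E(G)$, and $r_{B}$, $r_{C}$ for the rank functions of $B(G^*)$ and $C(G)$, the Las Vergnas polynomial of $G$ is the Tutte polynomial of the matroid perspective $B(G^*)\to C(G)$, $$L_G(x,y,z)=\sum_{A\subseteq E}(x-1)^{r_{C}(E)-r_{C}(A)}(y-1)^{|A|-r_{B}(A)}z^{(r_{B}(E)-r_{B}(A))-(r_{C}(E)-r_{C}(A))},$$ and the Bollobás–Riordan (ribbon graph) polynomial of $G$ is $$R_G(x,y,z)=\sum_{A\subseteq E}(x-1)^{r_G(E)-r_G(A)}\,y^{n_G(A)}\,z^{c_G(A)-f_G(A)+n_G(A)}.$$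 **Theorem.** If $\Sigma$ is the sphere (that is, $G$ is a plane graph) or the real projective plane, then $$L_G(t+1,t+1,1)=R_G(t+1,t,1/t).$$ If $\Sigma$ is the torus, then $$L_{2,G}(t+1,t+1)+t\,L_{1,G}(t+1,t+1)+L_{0,G}(t+1,t+1)=R_G(t+1,t,1/t),$$ where $L_{i,G}(x,y)\in\mathbb Z[x,y]$ is the coefficient of $z^i$ in $L_G(x,y,z)\in(\mathbb Z[x,y])[z]$. Both are identities of Laurent polynomials in $t$ over $\mathbb Z$. -/

import Mathlib

open scoped LaurentPolynomial

noncomputable section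

/-! ### Abstract graphs and their cycle matroids -/

/-- An abstract graph (loops and parallel edges allowed) with vertex set `V` and edge set `E`;
`ends e false` and `ends e true` are the two ends of the edge `e`. -/
structure Multigraph (V E : Type*) where
  ends : E → Bool → V

namespace Multigraph

variable {V E : Type*} (H : Multigraph V E)

/-- The vertices `u`, `w` are the two ends of an edge in `A`. -/
def Joined (A : Set E) (u w : V) : Prop := ∃ e ∈ A, H.ends e false = u ∧ H.ends e true = w

/-- The connected components of the spanning subgraph `(V, A)`: the classes of the equivalence
relation on the vertices generated by `Joined A`. -/
abbrev Component (A : Set E) : Type _ := Quot (H.Joined A)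

/-- `c(A)`, the number of components of the spanning subgraph `(V, A)`. -/
def c (A : Set E) : ℕ := Nat.card (H.Component A)

/-- `r(A) = v(A) - c(A)`, the rank of the spanning subgraph `(V, A)`. -/
def r (A : Set E) : ℕ := Nat.card V - H.c A

/-- `n(A) = e(A) - r(A)`, the nullity of the spanning subgraph `(V, A)`. -/
def n (A : Set E) : ℕ := A.ncard - H.r A

/-- The component of `(V, A)` that contains the vertex `u`. -/
abbrev comp (A : Set E) (u : V) : H.Component A := Quot.mk _ u

variable {H}

lemma comp_eq_of_mem {A : Set E} {e : E} (he : e ∈ A) :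
    H.comp A (H.ends e false) = H.comp A (H.ends e true) :=
  Quot.sound ⟨e, he, rfl, rfl⟩

/-- The map on components induced by adding edges. -/
def compMap {A B : Set E} (h : A ⊆ B) : H.Component A → H.Component B :=
  Quot.map id (fun _ _ ⟨e, he, h1, h2⟩ => ⟨e, h he, h1, h2⟩)

lemma compMap_surjective {A B : Set E} (h : A ⊆ B) :
    Function.Surjective (compMap (H := H) h) := by
  rintro ⟨u⟩
  exact ⟨Quot.mk _ u, rfl⟩

lemma c_anti [Finite V] {A B : Set E} (h : A ⊆ B) : H.c B ≤ H.c A :=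
  Nat.card_le_card_of_surjective _ (compMap_surjective h)

lemma c_le [Finite V] (A : Set E) : H.c A ≤ Nat.card V :=
  Nat.card_le_card_of_surjective (Quot.mk _) Quot.mk_surjective

lemma c_eq_of_joined [Finite V] {A B : Set E} (h : A ⊆ B)
    (hB : ∀ e ∈ B, H.comp A (H.ends e false) = H.comp A (H.ends e true)) : H.c B = H.c A := by
  refine (c_anti h).antisymm ?_
  refine Nat.card_le_card_of_surjective
    (Quot.lift (fun u => H.comp A u) ?_ : H.Component B → H.Component A) ?_
  · rintro u w ⟨e, he, rfl, rfl⟩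
    exact hB e he
  · rintro ⟨u⟩
    exact ⟨Quot.mk _ u, rfl⟩

open Classical in
lemma c_insert_of_not_joined [Finite V] {A : Set E} {e : E}
    (he : H.comp A (H.ends e false) ≠ H.comp A (H.ends e true)) :
    H.c (insert e A) + 1 = H.c A := by
  set p := H.comp A (H.ends e false) with hp
  set q := H.comp A (H.ends e true) with hq
  let s : H.Component (insert e A) → {x : H.Component A // x ≠ p} :=
    Quot.lift (fun u => if h : H.comp A u = p then ⟨q, he.symm⟩ else ⟨H.comp A u, h⟩) (by
      rintro u w ⟨f, hf, rfl, rfl⟩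
      rcases hf with rfl | hf
      · simp only [← hp, ← hq]
        simp [he.symm]
      · simp only [comp_eq_of_mem hf])
  have hs : Function.Bijective s := by
    constructor
    · have hl : Function.LeftInverse
          (fun x : {x : H.Component A // x ≠ p} => compMap (Set.subset_insert e A) x.1) s := by
        rintro ⟨u⟩
        by_cases h : H.comp A u = p
        · have h1 : s (Quot.mk _ u) = ⟨q, he.symm⟩ := dif_pos h
          have h2 := congrArg (compMap (Set.subset_insert e A)) h
          simp only [h1]
          calc compMap (Set.subset_insert e A) q
              = H.comp (insert e A) (H.ends e true) := rfl
            _ = H.comp (insert e A) (H.ends e false) :=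
                (comp_eq_of_mem (Set.mem_insert e A)).symm
            _ = compMap (Set.subset_insert e A) p := rfl
            _ = _ := h2.symm
        · have h1 : s (Quot.mk _ u) = ⟨H.comp A u, h⟩ := dif_neg h
          simp only [h1]
          rfl
      exact hl.injective
    · rintro ⟨⟨u⟩, h⟩
      exact ⟨Quot.mk _ u, dif_neg h⟩
  have h1 : H.c (insert e A) = Nat.card {x : H.Component A // x ≠ p} :=
    Nat.card_congr (Equiv.ofBijective s hs)
  have h2 : Nat.card {x : H.Component A // x ≠ p} + 1 = Nat.card (H.Component A) := by
    have := Nat.card_congr (Equiv.optionSubtypeNe p)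
    rw [← this, Finite.card_option]
  rw [h1, h2]; rfl

lemma r_mono [Finite V] {A B : Set E} (h : A ⊆ B) : H.r A ≤ H.r B :=
  Nat.sub_le_sub_left (c_anti h) _

lemma r_insert_of_joined [Finite V] {A : Set E} {e : E}
    (he : H.comp A (H.ends e false) = H.comp A (H.ends e true)) :
    H.r (insert e A) = H.r A := by
  unfold r
  rw [c_eq_of_joined (Set.subset_insert e A)]
  rintro f (rfl | hf)
  · exact he
  · exact comp_eq_of_mem hf

lemma r_insert_of_not_joined [Finite V] {A : Set E} {e : E}
    (he : H.comp A (H.ends e false) ≠ H.comp A (H.ends e true)) :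
    H.r (insert e A) = H.r A + 1 := by
  have h1 := c_insert_of_not_joined he
  have h2 := H.c_le A
  unfold r
  omega

lemma r_insert_le [Finite V] (A : Set E) (e : E) : H.r (insert e A) ≤ H.r A + 1 := by
  by_cases he : H.comp A (H.ends e false) = H.comp A (H.ends e true)
  · exact (r_insert_of_joined he).trans_le (Nat.le_succ _)
  · exact (r_insert_of_not_joined he).le

lemma r_union_le [Finite V] [Finite E] (A S : Set E) : H.r (A ∪ S) ≤ H.r A + S.ncard := by
  induction S, S.toFinite using Set.Finite.induction_on with
  | empty => simp
  | @insert a s ha hs ih =>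
    rw [Set.union_insert, Set.ncard_insert_of_notMem ha hs]
    exact (r_insert_le _ _).trans (by omega)

@[simp] lemma r_empty [Finite V] : H.r (∅ : Set E) = 0 := by
  have : H.c (∅ : Set E) = Nat.card V :=
    (H.c_le _).antisymm <| Nat.card_le_card_of_surjective
      (Quot.lift id (by rintro u w ⟨e, he, -⟩; exact he.elim) : H.Component ∅ → V)
      (fun u => ⟨Quot.mk _ u, rfl⟩)
  simp [r, this]

lemma r_le_ncard [Finite V] [Finite E] (A : Set E) : H.r A ≤ A.ncard := by
  simpa using r_union_le (H := H) ∅ A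

/-- If no edge of `J` increases the rank of `A`, then neither does all of `J`. -/
lemma r_union_eq [Finite V] {A J : Set E} (h : ∀ e ∈ J, e ∉ A → H.r (insert e A) ≤ H.r A) :
    H.r (A ∪ J) = H.r A := by
  unfold r
  rw [c_eq_of_joined Set.subset_union_left]
  intro e he
  by_cases heA : e ∈ A
  · exact comp_eq_of_mem heA
  · by_contra hne
    have h1 := r_insert_of_not_joined hne
    have h2 := h e (he.resolve_left heA) heA
    omega

variable (H)

/-- The cycle matroid `C(H)` on the edge set, whose rank function is `r(A) = v(A) - c(A)`
(see `cycleMatroid_eRk`): a set `A` of edges is independent if `r(A) = |A|`. -/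
def cycleMatroid [Finite V] [Finite E] : Matroid E :=
  (IndepMatroid.ofFinite (E := Set.univ) Set.finite_univ (fun I => H.r I = I.ncard)
    (by simp)
    (by
      intro I J hJ hIJ
      refine (r_le_ncard I).antisymm ?_
      have h1 := r_union_le (H := H) I (J \ I)
      rw [Set.union_sdiff_cancel hIJ, hJ] at h1
      have h2 := Set.ncard_sdiff_add_ncard_of_subset hIJ
      omega)
    (by
      intro I J hI hJ hlt
      by_contra! hcon
      replace hI : H.r I = I.ncard := hI
      replace hJ : H.r J = J.ncard := hJ
      have h1 : H.r (I ∪ J) = H.r I := by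
        refine r_union_eq fun e he heI => ?_
        have h2 : H.r (insert e I) ≠ (insert e I).ncard := hcon e he heI
        rw [Set.ncard_insert_of_notMem heI] at h2
        have h3 := r_insert_le (H := H) I e
        omega
      have h4 := r_mono (H := H) (Set.subset_union_right (s := I) (t := J))
      omega)
    (fun _ _ => Set.subset_univ _)).matroid

lemma cycleMatroid_indep [Finite V] [Finite E] (I : Set E) :
    H.cycleMatroid.Indep I ↔ H.r I = I.ncard := Iff.rfl

@[simp] lemma cycleMatroid_ground [Finite V] [Finite E] : H.cycleMatroid.E = Set.univ := rfl

lemma cycleMatroid_eRk [Finite V] [Finite E] (A : Set E) : H.cycleMatroid.eRk A = H.r A := by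
  obtain ⟨I, hI⟩ := H.cycleMatroid.exists_isBasis A (by simp)
  have hr := (H.cycleMatroid_indep I).1 hI.indep
  have h1 : H.r (I ∪ A) = H.r I := by
    refine r_union_eq fun e he heI => ?_
    have h2 : ¬ H.cycleMatroid.Indep (insert e I) := fun h => heI (hI.mem_of_insert_indep he h)
    rw [cycleMatroid_indep, Set.ncard_insert_of_notMem heI] at h2
    have h3 := r_insert_le (H := H) I e
    omega
  rw [Set.union_eq_self_of_subset_left hI.subset] at h1
  rw [hI.eRk_eq_encard, h1, hr, I.toFinite.cast_ncard_eq]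

/-- The bond matroid `B(H)`, the dual of the cycle matroid. -/
def bondMatroid [Finite V] [Finite E] : Matroid E := H.cycleMatroid✶

end Multigraph

/-! ### The Tutte polynomial of a matroid perspective -/

/-- The rank, as a natural number, of a set in a matroid (used on finite ground sets only). -/
def Matroid.natRk {E : Type*} (M : Matroid E) (X : Set E) : ℕ := (M.eRk X).toNat

/-- The Tutte polynomial `T_{M → M'}(x, y, z)` of a matroid perspective `M → M'` on the finite
set `E`, as an element of `(ℤ[x, y])[z]`; here `x = X 0` and `y = X 1`. For a matroid perspective
none of the natural number subtractions in the exponents is truncated. -/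
def perspectiveTutte {E : Type*} [Fintype E] (M M' : Matroid E) :
    Polynomial (MvPolynomial (Fin 2) ℤ) :=
  ∑ A : Finset E,
    Polynomial.C ((MvPolynomial.X 0 - 1) ^ (M'.natRk Set.univ - M'.natRk A)
      * (MvPolynomial.X 1 - 1) ^ (A.card - M.natRk A))
    * Polynomial.X ^ ((M.natRk Set.univ - M.natRk A) - (M'.natRk Set.univ - M'.natRk A))

/-! ### Ribbon graphs, that is, cellularly embedded graphs -/

/-- Each edge of a ribbon graph is a disc (a rectangle) that meets the vertex discs in two disjoint
segments. Its four corners are the end points of these segments: `(e, i, s)` is the corner of the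
edge `e` that lies on the `i`-th of its two ends (segments) and on the `s`-th of its two sides
(the arcs of the boundary of the rectangle that are disjoint from the interiors of the segments). -/
abbrev Corner (E : Type*) : Type _ := E × Bool × Bool

/-- The other end point of the segment in which the edge disc meets a vertex disc. -/
def Corner.acrossEnd {E : Type*} (x : Corner E) : Corner E := (x.1, x.2.1, !x.2.2)

/-- The other end point of the side of the edge disc. -/
def Corner.alongSide {E : Type*} (x : Corner E) : Corner E := (x.1, !x.2.1, x.2.2)

/-- A ribbon graph with vertex set `V` and edge set `E`, in its standard combinatorial description,
which determines it up to homeomorphism. The `i`-th end of the edge disc `e` is attached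
to the boundary circle of the vertex disc `att e i`. The end points of the attaching segments (the
corners) cut the boundary circle of a vertex disc into the attaching segments and free arcs, in
alternation, and `next x` is the other end point of the free arc that starts at the corner `x`.
A vertex at which no end is attached is an isolated disc. Capping each
boundary component of the ribbon graph with a disc gives a closed surface in which the underlying
graph is cellularly embedded, and each cellularly embedded finite graph arises so. -/
structure RibbonGraph (V E : Type*) where
  att : E → Bool → V
  next : Corner E → Corner E
  next_next : ∀ x, next (next x) = x
  next_ne : ∀ x, next x ≠ x
  /-- A free arc joins two corners on the same vertex disc. -/
  att_next : ∀ x, att (next x).1 (next x).2.1 = att x.1 x.2.1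
  /-- The boundary of a vertex disc is a single circle: any two corners on it are
  connected through free arcs and attaching segments. -/
  circle : ∀ x y : Corner E, att x.1 x.2.1 = att y.1 y.2.1 →
    Relation.EqvGen (fun a b => b = next a ∨ b = a.acrossEnd) x y

namespace RibbonGraph

variable {V E : Type*} (G : RibbonGraph V E)

/-- The underlying abstract graph. -/
def graph : Multigraph V E := ⟨G.att⟩

open Classical in
/-- Two corners that follow each other on the boundary of the spanning ribbon subgraph `(V, A)`.
This boundary consists of the free arcs of the vertex discs, of the sides of the edge
discs in `A`, and of the segments in which the deleted edges were attached. -/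
def BoundaryStep (A : Set E) (x y : Corner E) : Prop :=
  y = G.next x ∨ y = (if x.1 ∈ A then x.alongSide else x.acrossEnd)

/-- The boundary components of the spanning ribbon subgraph `(V, A)`: those through corners, and
the boundary circles of the vertex discs at which `G` has no edge. -/
abbrev BoundaryComponent (A : Set E) : Type _ :=
  Quot (G.BoundaryStep A) ⊕ {v : V // ∀ e i, G.att e i ≠ v}

/-- `f(A)`, the number of boundary components of the spanning ribbon subgraph `(V, A)`. -/
def f (A : Set E) : ℕ := Nat.card (G.BoundaryComponent A)

/-- The Euler genus of `G`, that is, of the closed surface obtained by capping the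
boundary components of `G` with discs, which has Euler characteristic `v(G) - e(G) + f(G)` and as
many connected components as `G`. -/
def eulerGenus : ℤ :=
  2 * G.graph.c Set.univ - (Nat.card V - Nat.card E + G.f Set.univ)

/-- The surface is orientable. At each corner three arcs meet (the attaching segment, the side of
the edge disc, the free arc), and a choice of one of the two local orientations of the surface there
is a choice of one of their two cyclic orders. Two corners joined by an arc have mirror image
pictures, so a consistent global choice is a 2-colouring of the corners in which neighbours along an
attaching segment, a side or a free arc get different colours. -/
def Orientable : Prop :=
  ∃ o : Corner E → Bool, ∀ x, o (G.next x) = !(o x) ∧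
    o x.acrossEnd = !(o x) ∧ o x.alongSide = !(o x)

/-- `G` is connected, and then so is its surface. -/
def Connected : Prop := G.graph.c Set.univ = 1

/-- `G` is cellularly embedded in the sphere (or plane), the connected closed surface of Euler
genus `0`. -/
def IsPlane : Prop := G.Connected ∧ G.eulerGenus = 0

/-- `G` is cellularly embedded in the real projective plane, the connected closed surface of Euler
genus `1`. -/
def IsProjectivePlane : Prop := G.Connected ∧ G.eulerGenus = 1

/-- `G` is cellularly embedded in the torus, the orientable connected closed surface of Euler
genus `2`. -/
def IsTorus : Prop := G.Connected ∧ G.Orientable ∧ G.eulerGenus = 2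

/-- A corner of `G` as a corner of the dual, in which the ends and sides of an edge
disc exchange their roles. -/
def flip (x : Corner E) : Corner E := (x.1, x.2.2, x.2.1)

/-- The vertex disc of the dual on which a corner of `G` lies: the boundary component of `G`
that contains it. -/
def face (x : Corner E) : G.BoundaryComponent Set.univ := Sum.inl (Quot.mk _ x)

lemma face_alongSide (x : Corner E) : G.face x.alongSide = G.face x :=
  congrArg Sum.inl (Quot.sound (r := G.BoundaryStep Set.univ) (Or.inr (by simp))).symm

lemma face_next (x : Corner E) : G.face (G.next x) = G.face x :=
  congrArg Sum.inl (Quot.sound (r := G.BoundaryStep Set.univ) (Or.inl rfl)).symm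

lemma face_end (e : E) (i s : Bool) : G.face (e, false, s) = G.face (e, i, s) := by
  cases i
  · rfl
  · exact (G.face_alongSide (e, false, s)).symm

/-- The geometric dual `G*`. Its vertex discs are the discs that cap the boundary
components of `G`, its edge discs are those of `G`, attached along their sides, and its free arcs
are those of `G`. -/
def dual : RibbonGraph (G.BoundaryComponent Set.univ) E where
  att e s := G.face (e, false, s)
  next x := flip (G.next (flip x))
  next_next x := by
    change flip (G.next (G.next (flip x))) = x
    rw [G.next_next]
    rfl
  next_ne x h := G.next_ne (flip x) (congrArg flip h)
  att_next x := by
    rw [G.face_end _ (G.next (flip x)).2.1, G.face_end x.1 x.2.2]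
    exact G.face_next (flip x)
  circle x y h := by
    rw [G.face_end x.1 x.2.2, G.face_end y.1 y.2.2] at h
    have h1 := Quot.eqvGen_exact (Sum.inl.inj h)
    have h2 : ∀ a b, Relation.EqvGen (G.BoundaryStep Set.univ) a b →
        Relation.EqvGen (fun a b => b = flip (G.next (flip a)) ∨ b = a.acrossEnd)
          (flip a) (flip b) := by
      intro a b hab
      induction hab with
      | rel a b hab =>
        refine .rel _ _ ?_
        rcases hab with rfl | rfl
        · exact Or.inl rfl
        · exact Or.inr (by simp [flip, Corner.alongSide, Corner.acrossEnd])
      | refl a => exact .refl _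
      | symm a b _ ih => exact .symm _ _ ih
      | trans a b c _ _ ih1 ih2 => exact .trans _ _ _ ih1 ih2
    exact h2 _ _ h1

/-- The Las Vergnas polynomial `L_G(x, y, z)`, the Tutte polynomial of the matroid
perspective `B(G*) → C(G)`, as an element of `(ℤ[x, y])[z]`. -/
def lasVergnas [Finite V] [Fintype E] : Polynomial (MvPolynomial (Fin 2) ℤ) :=
  perspectiveTutte G.dual.graph.bondMatroid G.graph.cycleMatroid

/-- The ribbon graph (Bollobás-Riordan) polynomial `R_G(x, y, z)`, as an element of `ℤ[x, y, z]`,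
with `x = X 0`, `y = X 1`, `z = X 2`. The last exponent is `c(A) - f(A) + n(A)`, which is the
Euler genus of the spanning ribbon subgraph `(V, A)` and hence is not truncated. -/
def bollobasRiordan [Fintype E] : MvPolynomial (Fin 3) ℤ :=
  ∑ A : Finset E,
    (MvPolynomial.X 0 - 1) ^ (G.graph.r Set.univ - G.graph.r A)
      * MvPolynomial.X 1 ^ G.graph.n A
      * MvPolynomial.X 2 ^ (G.graph.c A + G.graph.n A - G.f A)

end RibbonGraph

/-- The value `p(t + 1, t + 1)` of `p ∈ ℤ[x, y]` in the Laurent polynomials `ℤ[t, t⁻¹]`. -/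
def evalXY (p : MvPolynomial (Fin 2) ℤ) : ℤ[T;T⁻¹] :=
  MvPolynomial.aeval ![LaurentPolynomial.T 1 + 1, LaurentPolynomial.T 1 + 1] p

/-- The value `p(t + 1, t, 1 / t)` of `p ∈ ℤ[x, y, z]` in the Laurent polynomials `ℤ[t, t⁻¹]`. -/
def evalXYZ (p : MvPolynomial (Fin 3) ℤ) : ℤ[T;T⁻¹] :=
  MvPolynomial.aeval
    ![LaurentPolynomial.T 1 + 1, LaurentPolynomial.T 1, LaurentPolynomial.T (-1)] p

end

/-! At the point in question the term of `A` in `R_G` has exponent (c(A) - 1) + n(A) - (c(A) + n(A)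
- f(A)) = f(A) - 1. Writing c* for components in the dual, the term of `A` in `L_G` without its
power of z has exponent c(A) + c*(Aᶜ) - 2. So both identities can be checked one `A` at a time, by
controlling the defect k = f(A) + 1 - c(A) - c*(Aᶜ).

Let γ(A) = 2c(A) + |A| - |V| - f(A) be the Euler genus of (V, A), and γ*(Aᶜ) that of the
complementary subgraph of the dual. The latter has the same boundary components (`f_dual_compl`),
and the dual has f(E) vertices, so for connected G γ(A) + γ*(Aᶜ) = γ(G) - 2k. Genera are nonnegative
(`f_add_card_le`, adding edges one at a time). Also k ≥ 0 (`c_add_c_dual_le`): the boundary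
components are the edges of a connected graph whose vertices are the components on the two sides.
Hence 0 ≤ 2k ≤ γ(G), and k = 0 when γ(G) ≤ 1.

On the torus k is 0 or 1, and the exponent of z equals γ*(Aᶜ) + k. If k = 1, both genera vanish and
the degree is 1; the factor t on L₁ supplies the missing power. If k = 0, the genera add up to 2 and
are even by orientability (`Orientable.even`), so the degree is 0 or 2. The parity comes from the
sign of the boundary permutation, which each added edge multiplies by a transposition. -/

noncomputable section

/-! ### Counting the classes generated by a relation -/

/-- The pairs of elements of `α`, as the edges of a multigraph. A set of edges is a relation. -/
def pairGraph (α : Type*) : Multigraph α (α × α) := ⟨fun p i => if i then p.2 else p.1⟩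

namespace pairGraph

variable {α : Type*}

lemma joined_iff (R : Set (α × α)) (x y : α) : (pairGraph α).Joined R x y ↔ (x, y) ∈ R := by
  constructor
  · rintro ⟨p, hp, rfl, rfl⟩
    simpa [pairGraph] using hp
  · intro h
    exact ⟨(x, y), h, by simp [pairGraph], by simp [pairGraph]⟩

lemma comp_eq {R : Set (α × α)} {x y : α} (h : (x, y) ∈ R) :
    (pairGraph α).comp R x = (pairGraph α).comp R y :=
  Quot.sound ((joined_iff R x y).2 h)

lemma c_eq_card_quot (r : α → α → Prop) :
    (pairGraph α).c {p | r p.1 p.2} = Nat.card (Quot r) := by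
  have : (pairGraph α).Joined {p | r p.1 p.2} = r := by
    ext x y
    exact joined_iff _ x y
  unfold Multigraph.c Multigraph.Component
  rw [this]

lemma comp_mono {R S : Set (α × α)} (h : R ⊆ S) {x y : α}
    (hxy : (pairGraph α).comp R x = (pairGraph α).comp R y) :
    (pairGraph α).comp S x = (pairGraph α).comp S y :=
  congrArg (Multigraph.compMap h) hxy

variable [Finite α]

lemma c_eq_of_comp_eq {R S : Set (α × α)} (h : R ⊆ S)
    (hS : ∀ p ∈ S, (pairGraph α).comp R p.1 = (pairGraph α).comp R p.2) :
    (pairGraph α).c S = (pairGraph α).c R :=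
  Multigraph.c_eq_of_joined h (by simpa [pairGraph] using hS)

/-- Adjoining `R` to `S` merges no classes of `S`, and the union is coarser than `R`. -/
lemma c_le_of_comp_eq {R S : Set (α × α)}
    (h : ∀ p ∈ R, (pairGraph α).comp S p.1 = (pairGraph α).comp S p.2) :
    (pairGraph α).c S ≤ (pairGraph α).c R := by
  rw [← c_eq_of_comp_eq (R := S) (S := S ∪ R) Set.subset_union_left]
  · exact Multigraph.c_anti Set.subset_union_right
  · rintro p (hp | hp)
    · exact comp_eq hp
    · exact h p hp

lemma c_insert_add_one {R : Set (α × α)} {x y : α}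
    (h : (pairGraph α).comp R x ≠ (pairGraph α).comp R y) :
    (pairGraph α).c (insert (x, y) R) + 1 = (pairGraph α).c R :=
  Multigraph.c_insert_of_not_joined (by simpa [pairGraph] using h)

lemma c_le_c_insert_add_one (R : Set (α × α)) (x y : α) :
    (pairGraph α).c R ≤ (pairGraph α).c (insert (x, y) R) + 1 := by
  by_cases h : (pairGraph α).comp R x = (pairGraph α).comp R y
  · rw [c_eq_of_comp_eq (Set.subset_insert _ R)]
    · omega
    · rintro p (rfl | hp)
      · exact h
      · exact comp_eq hp
  · exact (c_insert_add_one h).ge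

end pairGraph

/-! ### Sign of a permutation and number of orbits -/

namespace Equiv.Perm

/-- The sign of a permutation in terms of its number of orbits. -/
lemma sign_eq_neg_one_pow_card_orbits {α : Type*} [Fintype α] [DecidableEq α]
    (σ : Perm α) : sign σ = (-1) ^ (Fintype.card α + Nat.card (Quot σ.SameCycle)) := by
  let F : Quot σ.SameCycle → σ.cycleFactorsFinset ⊕ Function.fixedPoints σ :=
    Quot.lift (fun x => if h : σ x = x then Sum.inr ⟨x, h⟩
      else Sum.inl ⟨σ.cycleOf x, cycleOf_mem_cycleFactorsFinset_iff.2 (mem_support.2 h)⟩) (by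
      intro x y hxy
      by_cases h : σ x = x
      · have : x = y := hxy.eq_of_left h
        subst this
        rfl
      · have h' : σ y ≠ y := fun hy => h ((hxy.apply_eq_self_iff).2 hy)
        simp only [h, h', dite_false, Sum.inl.injEq, Subtype.mk.injEq]
        exact hxy.cycleOf_eq)
  have hfix : ∀ x (h : σ x = x), F (Quot.mk _ x) = Sum.inr ⟨x, h⟩ := fun x h => dif_pos h
  have hmove : ∀ x (h : σ x ≠ x), F (Quot.mk _ x) =
      Sum.inl ⟨σ.cycleOf x, cycleOf_mem_cycleFactorsFinset_iff.2 (mem_support.2 h)⟩ :=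
    fun x h => dif_neg h
  have hF : Function.Bijective F := by
    constructor
    · rintro ⟨x⟩ ⟨y⟩ h
      apply Quot.sound
      by_cases hx : σ x = x <;> by_cases hy : σ y = y
      · rw [hfix x hx, hfix y hy, Sum.inr.injEq] at h
        exact (congrArg Subtype.val h : x = y).sameCycle σ
      · rw [hfix x hx, hmove y hy] at h
        cases h
      · rw [hmove x hx, hfix y hy] at h
        cases h
      · rw [hmove x hx, hmove y hy, Sum.inl.injEq, Subtype.mk.injEq] at h
        exact (sameCycle_iff_cycleOf_eq_of_mem_support (mem_support.2 hx)
          (mem_support.2 hy)).2 h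
    · rintro (⟨p, hp⟩ | ⟨x, hx⟩)
      · obtain ⟨x, hx⟩ := (mem_cycleFactorsFinset_iff.1 hp).1.nonempty_support
        have hpx := cycle_is_cycleOf hx hp
        have h : σ x ≠ x := mem_support.1 (mem_cycleFactorsFinset_support_le hp hx)
        refine ⟨Quot.mk _ x, ?_⟩
        rw [hmove x h]
        simp [← hpx]
      · exact ⟨Quot.mk _ x, hfix x hx⟩
  have h1 : Nat.card (Quot σ.SameCycle) =
      σ.cycleFactorsFinset.card + Fintype.card (Function.fixedPoints σ) := by
    rw [Nat.card_congr (Equiv.ofBijective F hF), Nat.card_sum]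
    simp
  have h2 : σ.cycleType.card = σ.cycleFactorsFinset.card := by simp [cycleType_def]
  have h3 := card_fixedPoints σ
  have h4 := sum_cycleType_le σ
  -- The sign has exponent (moved points) + (nontrivial cycles). Each fixed point adds one to the
  -- number of points and one to the number of orbits, so parity is unaffected.
  rw [sign_of_cycleType, h1, h2, neg_one_pow_congr]
  have h5 : Fintype.card α = σ.cycleType.sum + Fintype.card (Function.fixedPoints σ) := by omega
  rw [h5]
  simp only [Nat.even_add]
  tauto

end Equiv.Perm

/-! ### Ranks in the cycle and bond matroids -/

namespace Multigraph

variable {V E : Type*} (H : Multigraph V E) [Finite V]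

lemma r_eq (A : Set E) : H.r A + H.c A = Nat.card V := by
  have := H.c_le A
  unfold r
  omega

variable [Finite E]

lemma natRk_cycleMatroid (A : Set E) : H.cycleMatroid.natRk A = H.r A := by
  simp [Matroid.natRk, cycleMatroid_eRk]

lemma natRk_bondMatroid (A : Set E) :
    H.bondMatroid.natRk A + H.r Set.univ = A.ncard + H.r Aᶜ := by
  have h := H.cycleMatroid.eRk_dual_add_eRank A
  rw [Matroid.eRank_def, cycleMatroid_ground, cycleMatroid_eRk, cycleMatroid_eRk,
    ← Set.compl_eq_univ_sdiff, ← A.toFinite.cast_ncard_eq] at h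
  have h1 : H.cycleMatroid✶.eRk A ≠ ⊤ := by
    intro h1
    rw [h1, top_add] at h
    exact ENat.natCast_ne_top _ (by exact_mod_cast h.symm)
  lift H.cycleMatroid✶.eRk A to ℕ using h1 with k hk
  have h2 : H.bondMatroid.natRk A = k := by
    simp [Matroid.natRk, bondMatroid, ← hk]
  have h3 : k + H.r Set.univ = H.r Aᶜ + A.ncard := by exact_mod_cast h
  omega

end Multigraph

/-! ### Effect of one edge on the boundary components -/

/-- A sum over the elements of a finite type that is invariant under an involution without fixed
points on the support vanishes modulo `2`. -/
lemma sum_ite_eq_zero_of_involutive {α : Type*} [Fintype α] (p : α → Prop) [DecidablePred p]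
    (g : α → α) (hg : ∀ x, g (g x) = x) (hne : ∀ x, g x ≠ x) (hp : ∀ x, p x → p (g x)) :
    ∑ x, (if p x then 1 else 0 : ZMod 2) = 0 := by
  refine Finset.sum_involution (fun x _ => g x) (fun x _ => ?_) (fun x _ _ => hne x)
    (fun x _ => Finset.mem_univ _) (fun x _ => hg x)
  by_cases h : p x
  · simp only [h, hp x h, if_true]
    decide
  · have h' : ¬ p (g x) := fun h' => h (by simpa [hg] using hp _ h')
    simp [h, h']

namespace RibbonGraph

variable {V E : Type*} (G : RibbonGraph V E)

open Classical in
/-- The corner that is joined to `x` on the boundary of the spanning ribbon subgraph `(V, A)` by a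
side of an edge disc or by an attaching segment. -/
def mate (A : Set E) (x : Corner E) : Corner E := if x.1 ∈ A then x.alongSide else x.acrossEnd

lemma mate_of_mem {A : Set E} {x : Corner E} (h : x.1 ∈ A) : mate A x = x.alongSide := if_pos h

lemma mate_of_notMem {A : Set E} {x : Corner E} (h : x.1 ∉ A) : mate A x = x.acrossEnd := if_neg h

lemma mate_fst (A : Set E) (x : Corner E) : (mate A x).1 = x.1 := by
  by_cases h : x.1 ∈ A
  · rw [mate_of_mem h]
    rfl
  · rw [mate_of_notMem h]
    rfl

lemma mate_mate (A : Set E) (x : Corner E) : mate A (mate A x) = x := by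
  by_cases h : x.1 ∈ A
  · rw [mate_of_mem h, mate_of_mem (by exact h)]
    simp [Corner.alongSide]
  · rw [mate_of_notMem h, mate_of_notMem (by exact h)]
    simp [Corner.acrossEnd]

lemma mate_ne (A : Set E) (x : Corner E) : mate A x ≠ x := by
  obtain ⟨e, i, s⟩ := x
  by_cases h : e ∈ A
  · rw [mate_of_mem (by exact h)]
    cases i <;> simp [Corner.alongSide]
  · rw [mate_of_notMem (by exact h)]
    cases s <;> simp [Corner.acrossEnd]

lemma boundaryStep_iff {A : Set E} {x y : Corner E} :
    G.BoundaryStep A x y ↔ y = G.next x ∨ y = mate A x := Iff.rfl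

/-- The pairs of successive corners on the boundary of `(V, A)`. -/
def stepSet (A : Set E) : Set (Corner E × Corner E) := {p | G.BoundaryStep A p.1 p.2}

/-- The pairs of successive corners on the boundary of `(V, A)`, except for those on the boundary
of the edge disc `e`. -/
def stepSetOff (A : Set E) (e : E) : Set (Corner E × Corner E) :=
  {p | p.2 = G.next p.1 ∨ p.1.1 ≠ e ∧ p.2 = mate A p.1}

lemma f_eq [Finite V] [Finite E] (A : Set E) :
    G.f A = (pairGraph (Corner E)).c (G.stepSet A) + Nat.card {v : V // ∀ e i, G.att e i ≠ v} := by
  rw [f, Nat.card_sum, stepSet, pairGraph.c_eq_card_quot]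

lemma stepSetOff_subset (A : Set E) (e : E) : G.stepSetOff A e ⊆ G.stepSet A := by
  rintro p (h | ⟨-, h⟩)
  · exact Or.inl h
  · exact Or.inr h

lemma stepSetOff_insert (A : Set E) (e : E) :
    G.stepSetOff (insert e A) e = G.stepSetOff A e := by
  have h : ∀ x : Corner E, x.1 ≠ e → mate (insert e A) x = mate A x := by
    intro x hx
    by_cases h : x.1 ∈ A
    · rw [mate_of_mem h, mate_of_mem (Set.mem_insert_of_mem _ h)]
    · rw [mate_of_notMem h, mate_of_notMem (by simp [hx, h])]
  ext ⟨x, y⟩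
  simp only [stepSetOff, Set.mem_ofPred_eq]
  refine or_congr_right (and_congr_right fun hx => ?_)
  rw [h x hx]

/-- The corners of `e` on a common path of the boundary of `(V, A)` with the boundary of `e`
removed are even in number. -/
lemma sum_corners_eq_zero [Finite E] (A : Set E) (e : E)
    (q : (pairGraph (Corner E)).Component (G.stepSetOff A e)) (p : Bool → Bool → Prop)
    [∀ i s, Decidable (p i s)]
    (hp : ∀ i s, p i s ↔ (pairGraph (Corner E)).comp (G.stepSetOff A e) (e, i, s) = q) :
    ∑ i, ∑ s, (if p i s then 1 else 0 : ZMod 2) = 0 := by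
  classical
  have := Fintype.ofFinite E
  set P := (pairGraph (Corner E)).comp (G.stepSetOff A e) with hP
  -- Two fixed-point-free involutions preserve the class `q`: `next` on all its corners, `mate A` on
  -- those off `e`. The difference of these two even counts is the number of corners of `e` in `q`.
  have h1 := sum_ite_eq_zero_of_involutive (fun x : Corner E => P x = q) G.next G.next_next
    G.next_ne (by
      rintro x rfl
      exact (pairGraph.comp_eq (Or.inl rfl)).symm)
  have h2 := sum_ite_eq_zero_of_involutive (fun x : Corner E => P x = q ∧ x.1 ≠ e) (mate A)
    (mate_mate A) (mate_ne A) (by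
      rintro x ⟨rfl, hx⟩
      refine ⟨(pairGraph.comp_eq (Or.inr ⟨hx, rfl⟩)).symm, ?_⟩
      rwa [mate_fst])
  have h3 : ∀ x : Corner E, (if P x = q then 1 else 0 : ZMod 2) =
      (if P x = q ∧ x.1 ≠ e then 1 else 0) + if x.1 = e then (if P x = q then 1 else 0) else 0 := by
    intro x
    by_cases hx : x.1 = e <;> simp [hx]
  rw [Finset.sum_congr rfl fun x _ => h3 x, Finset.sum_add_distrib, h2, zero_add,
    Fintype.sum_prod_type, Fintype.sum_eq_single e (fun e' he' => by simp [he'])] at h1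
  simpa only [hp, Fintype.sum_prod_type, if_true] using h1

/-- The path through a corner of `e` ends at another corner of `e`, and the remaining two corners
are joined as well. -/
lemma corners_paired [Finite E] (A : Set E) (e : E)
    {P : Bool → Bool → (pairGraph (Corner E)).Component (G.stepSetOff A e)}
    (hP : ∀ i s, P i s = (pairGraph (Corner E)).comp (G.stepSetOff A e) (e, i, s)) :
    (P false false = P false true ∧ P true false = P true true) ∨
    (P false false = P true false ∧ P false true = P true true) ∨
    (P false false = P true true ∧ P false true = P true false) := by
  classical
  -- Every class meets the four corners in an even number, and a partition of four points into even
  -- blocks is refined by one of the three pairings.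
  have key := fun q => G.sum_corners_eq_zero A e q (fun i s => P i s = q)
    (fun i s => by rw [hP])
  simp only [Fintype.sum_bool] at key
  have h1 := key (P false false)
  have h2 := key (P false true)
  have h3 := key (P true false)
  have h4 := key (P true true)
  have h11 : (1 : ZMod 2) + 1 = 0 := by decide
  grind

lemma stepSet_comp_of_mem {A : Set E} {e : E} (he : e ∈ A) (i s : Bool) :
    (pairGraph (Corner E)).comp (G.stepSet A) (e, i, s) =
      (pairGraph (Corner E)).comp (G.stepSet A) (e, !i, s) :=
  pairGraph.comp_eq (Or.inr (mate_of_mem (x := (e, i, s)) he).symm)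

variable [Finite V] [Finite E]

/-- The steps lost on inserting `e` are those across its two ends. If the corners of one end stay
connected, so do those of the other, via the sides, and no boundary component splits. A side joining
two distinct old components then merges them. -/
lemma f_insert_le_of_comp_eq {A : Set E} {e : E} (he : e ∉ A)
    (h0 : (pairGraph (Corner E)).comp (G.stepSet (insert e A)) (e, false, false) =
      (pairGraph (Corner E)).comp (G.stepSet (insert e A)) (e, false, true)) :
    G.f (insert e A) ≤ G.f A ∧
      ((pairGraph (Corner E)).comp (G.stepSet A) (e, false, false) ≠
        (pairGraph (Corner E)).comp (G.stepSet A) (e, true, false) →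
      G.f (insert e A) + 1 ≤ G.f A) := by
  have hm : e ∈ insert e A := Set.mem_insert e A
  have h1 : (pairGraph (Corner E)).comp (G.stepSet (insert e A)) (e, true, false) =
      (pairGraph (Corner E)).comp (G.stepSet (insert e A)) (e, true, true) := by
    rw [G.stepSet_comp_of_mem hm true, G.stepSet_comp_of_mem hm true]
    exact h0
  have h2 : ∀ p ∈ G.stepSet A, (pairGraph (Corner E)).comp (G.stepSet (insert e A)) p.1 =
      (pairGraph (Corner E)).comp (G.stepSet (insert e A)) p.2 := by
    rintro ⟨⟨e', i, s⟩, y⟩ (hy | hy)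
    · exact pairGraph.comp_eq (Or.inl hy)
    · by_cases h : e' = e
      · subst h
        change y = mate A (e', i, s) at hy
        rw [mate_of_notMem (by exact he)] at hy
        subst hy
        cases i <;> cases s <;> simp only [Corner.acrossEnd, Bool.not_true, Bool.not_false]
        · exact h0
        · exact h0.symm
        · exact h1
        · exact h1.symm
      · refine pairGraph.comp_eq (G.stepSetOff_subset _ e ?_)
        rw [stepSetOff_insert]
        exact Or.inr ⟨h, hy⟩
  rw [f_eq, f_eq]
  refine ⟨Nat.add_le_add_right (pairGraph.c_le_of_comp_eq h2) _, fun h => ?_⟩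
  have h3 := pairGraph.c_insert_add_one h
  have h4 : (pairGraph (Corner E)).c (G.stepSet (insert e A)) ≤
      (pairGraph (Corner E)).c (insert ((e, false, false), (e, true, false)) (G.stepSet A)) := by
    refine pairGraph.c_le_of_comp_eq ?_
    rintro p (rfl | hp)
    · exact G.stepSet_comp_of_mem hm _ _
    · exact h2 p hp
  omega

/-- With the boundary of `e` removed, the four corners are paired by paths. Only paths joining the
two ends along the same side (an untwisted band) allow an increase. Then restoring one end step
already connects all four corners, so it yields all old connections at the cost of at most one
class. -/
lemma f_insert_le {A : Set E} {e : E} (he : e ∉ A) : G.f (insert e A) ≤ G.f A + 1 := by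
  have hsub := G.stepSetOff_subset (insert e A) e
  rw [stepSetOff_insert] at hsub
  have hm : e ∈ insert e A := Set.mem_insert e A
  rcases G.corners_paired A e (fun _ _ => rfl) with ⟨h1, -⟩ | ⟨h1, h2⟩ | ⟨h1, h2⟩
  · exact (G.f_insert_le_of_comp_eq he (pairGraph.comp_mono hsub h1)).1.trans (Nat.le_succ _)
  · rw [f_eq, f_eq]
    have h3 := Multigraph.c_anti (H := pairGraph (Corner E)) hsub
    have h4 := pairGraph.c_le_c_insert_add_one (G.stepSetOff A e) (e, false, false) (e, false, true)
    have h5 : (pairGraph (Corner E)).c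
        (insert ((e, false, false), (e, false, true)) (G.stepSetOff A e)) ≤
        (pairGraph (Corner E)).c (G.stepSet A) := by
      refine pairGraph.c_le_of_comp_eq ?_
      have hs := Set.subset_insert ((e, false, false), (e, false, true)) (G.stepSetOff A e)
      have h6 : (pairGraph (Corner E)).comp
          (insert ((e, false, false), (e, false, true)) (G.stepSetOff A e)) (e, false, false) =
          (pairGraph (Corner E)).comp
          (insert ((e, false, false), (e, false, true)) (G.stepSetOff A e)) (e, false, true) :=
        pairGraph.comp_eq (Set.mem_insert _ _)
      have h7 := pairGraph.comp_mono hs h1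
      have h8 := pairGraph.comp_mono hs h2
      rintro ⟨⟨e', i, s⟩, y⟩ (hy | hy)
      · exact pairGraph.comp_eq (Or.inr (Or.inl hy))
      · by_cases h : e' = e
        · subst h
          change y = mate A (e', i, s) at hy
          rw [mate_of_notMem (by exact he)] at hy
          subst hy
          cases i <;> cases s <;> simp only [Corner.acrossEnd, Bool.not_true, Bool.not_false]
          · exact h6
          · exact h6.symm
          · rw [← h7, ← h8, h6]
          · rw [← h7, ← h8, h6]
        · exact pairGraph.comp_eq (Or.inr (Or.inr ⟨h, hy⟩))
    omega
  · refine (G.f_insert_le_of_comp_eq he ?_).1.trans (Nat.le_succ _)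
    rw [pairGraph.comp_mono hsub h2]
    exact G.stepSet_comp_of_mem hm _ _

end RibbonGraph

/-! ### Boundary components, duality and the Euler genus -/

lemma pairGraph.apply_eq_of_comp_eq {α β : Type*} {R : Set (α × α)} (g : α → β)
    (hg : ∀ p ∈ R, g p.1 = g p.2) {x y : α}
    (h : (pairGraph α).comp R x = (pairGraph α).comp R y) : g x = g y :=
  congrArg (Quot.lift g (fun _ _ hxy => hg _ ((joined_iff R _ _).1 hxy)) :
    (pairGraph α).Component R → β) h

namespace RibbonGraph

variable {V E : Type*} (G : RibbonGraph V E)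

lemma comp_att_of_boundaryStep {A : Set E} {x y : Corner E} (h : G.BoundaryStep A x y) :
    G.graph.comp A (G.att x.1 x.2.1) = G.graph.comp A (G.att y.1 y.2.1) := by
  rcases G.boundaryStep_iff.1 h with rfl | rfl
  · rw [G.att_next]
  · by_cases hx : x.1 ∈ A
    · rw [mate_of_mem hx]
      have h1 : G.graph.comp A (G.att x.1 false) = G.graph.comp A (G.att x.1 true) :=
        Multigraph.comp_eq_of_mem (H := G.graph) hx
      obtain ⟨e, i, s⟩ := x
      cases i
      · exact h1
      · exact h1.symm
    · rw [mate_of_notMem hx]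
      rfl

lemma comp_face_of_boundaryStep {A : Set E} {x y : Corner E} (h : G.BoundaryStep A x y) :
    G.dual.graph.comp Aᶜ (G.face x) = G.dual.graph.comp Aᶜ (G.face y) := by
  rcases G.boundaryStep_iff.1 h with rfl | rfl
  · rw [G.face_next]
  · by_cases hx : x.1 ∈ A
    · rw [mate_of_mem hx, G.face_alongSide]
    · rw [mate_of_notMem hx]
      obtain ⟨e, i, s⟩ := x
      have h1 : G.dual.graph.comp Aᶜ (G.face (e, false, false)) =
          G.dual.graph.comp Aᶜ (G.face (e, false, true)) :=
        Multigraph.comp_eq_of_mem (H := G.dual.graph) hx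
      rw [G.face_end e i, G.face_end e i] at h1
      cases s
      · exact h1
      · exact h1.symm

/-- The component of `(V, A)` that contains a boundary component. -/
def boundaryComp (A : Set E) : G.BoundaryComponent A → G.graph.Component A :=
  Sum.elim (Quot.lift (fun x => G.graph.comp A (G.att x.1 x.2.1))
    (fun _ _ => G.comp_att_of_boundaryStep)) (fun w => G.graph.comp A w)

/-- The component of the complementary spanning subgraph of the dual that contains a boundary
component of `(V, A)`. -/
def boundaryDualComp (A : Set E) : G.BoundaryComponent A → G.dual.graph.Component Aᶜ :=
  Sum.elim (Quot.lift (fun x => G.dual.graph.comp Aᶜ (G.face x))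
    (fun _ _ => G.comp_face_of_boundaryStep)) (fun w => G.dual.graph.comp Aᶜ (Sum.inr w))

/-- The bipartite graph of the components of `(V, A)` and those of the complementary spanning
subgraph of the dual; its edges are the boundary components of `(V, A)`. -/
def interfaceGraph (A : Set E) :
    Multigraph (G.graph.Component A ⊕ G.dual.graph.Component Aᶜ) (G.BoundaryComponent A) :=
  ⟨fun b i => if i then Sum.inr (G.boundaryDualComp A b) else Sum.inl (G.boundaryComp A b)⟩

lemma interfaceGraph_comp (A : Set E) (b : G.BoundaryComponent A) :
    (G.interfaceGraph A).comp Set.univ (Sum.inl (G.boundaryComp A b)) =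
      (G.interfaceGraph A).comp Set.univ (Sum.inr (G.boundaryDualComp A b)) :=
  Multigraph.comp_eq_of_mem (H := G.interfaceGraph A) (Set.mem_univ b)

lemma interfaceGraph_comp_corner (A : Set E) (x : Corner E) :
    (G.interfaceGraph A).comp Set.univ (Sum.inl (G.graph.comp A (G.att x.1 x.2.1))) =
      (G.interfaceGraph A).comp Set.univ (Sum.inr (G.dual.graph.comp Aᶜ (G.face x))) :=
  G.interfaceGraph_comp A (Sum.inl (Quot.mk _ x))

lemma c_empty [Finite V] : G.graph.c ∅ = Nat.card V := by
  have h1 := G.graph.r_eq ∅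
  rwa [Multigraph.r_empty, zero_add] at h1

lemma c_pos [Finite V] {G : RibbonGraph V E} (hG : G.Connected) (A : Set E) : 1 ≤ G.graph.c A := by
  have h := Multigraph.c_anti (H := G.graph) (Set.subset_univ A)
  rwa [hG] at h

/-- Without edges the boundary consists of the circles of the vertex discs; injectivity is the axiom
`circle`. -/
lemma f_empty : G.f ∅ = Nat.card V := by
  refine Nat.card_congr (Equiv.ofBijective (Sum.elim (Quot.lift (fun x => G.att x.1 x.2.1) ?_)
    Subtype.val) ⟨?_, ?_⟩)
  · rintro x y h
    rcases G.boundaryStep_iff.1 h with rfl | rfl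
    · rw [G.att_next]
    · rw [mate_of_notMem (Set.notMem_empty _)]
      rfl
  · rintro (⟨⟨x⟩⟩ | ⟨w, hw⟩) (⟨⟨y⟩⟩ | ⟨w', hw'⟩) h
    · refine congrArg Sum.inl (Quot.eqvGen_sound ((G.circle x y h).mono ?_))
      rintro a b (rfl | rfl)
      · exact Or.inl rfl
      · exact Or.inr (mate_of_notMem (Set.notMem_empty _)).symm
    · exact (hw' _ _ h).elim
    · exact (hw _ _ h.symm).elim
    · exact congrArg Sum.inr (Subtype.ext h)
  · intro w
    by_cases h : ∀ e i, G.att e i ≠ w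
    · exact ⟨Sum.inr ⟨w, h⟩, rfl⟩
    · push Not at h
      obtain ⟨e, i, rfl⟩ := h
      exact ⟨Sum.inl (Quot.mk _ (e, i, false)), rfl⟩

lemma flip_mate (A : Set E) (x : Corner E) : flip (mate A x) = mate Aᶜ (flip x) := by
  by_cases h : x.1 ∈ A
  · rw [mate_of_mem h, mate_of_notMem (by simpa [flip] using h)]
    rfl
  · rw [mate_of_notMem h, mate_of_mem (by simpa [flip] using h)]
    rfl

/-- The dual exchanges sides and ends of each edge disc, and complementation exchanges which of them
are followed, so `flip` carries one boundary walk to the other. -/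
lemma f_dual_compl (A : Set E) : G.dual.f Aᶜ = G.f A := by
  have hflip : Function.Involutive (flip (E := E)) := fun _ => rfl
  have hstep : ∀ x y, G.BoundaryStep A x y ↔
      G.dual.BoundaryStep Aᶜ (Function.Involutive.toPerm _ hflip x)
        (Function.Involutive.toPerm _ hflip y) := by
    intro x y
    rw [boundaryStep_iff, boundaryStep_iff]
    change _ ↔ flip y = flip (G.next (flip (flip x))) ∨ flip y = mate Aᶜ (flip x)
    rw [← flip_mate, hflip.injective.eq_iff, hflip.injective.eq_iff]
    rfl
  let g : {v : V // ∀ e i, G.att e i ≠ v} →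
      {b : G.BoundaryComponent Set.univ // ∀ e i, G.dual.att e i ≠ b} :=
    fun w => ⟨Sum.inr w, fun e i h => by cases h⟩
  have hg : Function.Bijective g := by
    constructor
    · intro w w' h
      exact Sum.inr.inj (congrArg Subtype.val h)
    · rintro ⟨⟨⟨e, i, s⟩⟩ | w, hw⟩
      · exact (hw e s (G.face_end e i s)).elim
      · exact ⟨w, rfl⟩
  exact (Nat.card_congr (Equiv.sumCongr (Quot.congr (Function.Involutive.toPerm _ hflip) hstep)
    (Equiv.ofBijective g hg))).symm

/-- Vertices of `G` hit every class, since each face shares a boundary component with some vertex.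
Adjacent vertices fall in the same class, because both ends of an edge meet the face along one of
its sides. -/
lemma interfaceGraph_c_le [Finite V] (A : Set E) :
    (G.interfaceGraph A).c Set.univ ≤ G.graph.c Set.univ := by
  refine Nat.card_le_card_of_surjective (Quot.lift (fun u =>
    (G.interfaceGraph A).comp Set.univ (Sum.inl (G.graph.comp A u))) ?_) ?_
  · rintro u w ⟨e, -, rfl, rfl⟩
    refine (G.interfaceGraph_comp_corner A (e, false, false)).trans
      (Eq.trans ?_ (G.interfaceGraph_comp_corner A (e, true, false)).symm)
    rw [G.face_end e true]
  · rintro ⟨⟨⟨u⟩⟩ | ⟨⟨⟨⟨x⟩⟩ | w⟩⟩⟩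
    · exact ⟨Quot.mk _ u, rfl⟩
    · exact ⟨Quot.mk _ (G.att x.1 x.2.1), G.interfaceGraph_comp_corner A x⟩
    · exact ⟨Quot.mk _ w.1, G.interfaceGraph_comp A (Sum.inr w)⟩

variable [Finite V] [Finite E]

/-- The Euler genus of a spanning ribbon subgraph is not negative. -/
lemma f_add_card_le (A : Set E) : G.f A + Nat.card V ≤ 2 * G.graph.c A + A.ncard := by
  induction A, A.toFinite using Set.Finite.induction_on with
  | empty =>
    rw [f_empty, c_empty]
    simp
    omega
  | @insert e A he _ ih =>
    rw [Set.ncard_insert_of_notMem he]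
    -- If the ends are already connected, the right side grows by one, as `f` may. Otherwise the
    -- right side drops by one, so `f` must drop too.
    by_cases h : G.graph.comp A (G.att e false) = G.graph.comp A (G.att e true)
    · have h1 : G.graph.c (insert e A) = G.graph.c A := by
        refine Multigraph.c_eq_of_joined (Set.subset_insert e A) ?_
        rintro e' (rfl | he')
        · exact h
        · exact Multigraph.comp_eq_of_mem he'
      have h2 := G.f_insert_le he
      omega
    · have h1 : G.graph.c (insert e A) + 1 = G.graph.c A := Multigraph.c_insert_of_not_joined h
      have hsub := G.stepSetOff_subset (insert e A) e
      rw [stepSetOff_insert] at hsub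
      -- A boundary component stays within one component of the subgraph, so no old boundary path
      -- links the two ends of `e`. Only the first pairing survives.
      have hne : ∀ s s', (pairGraph (Corner E)).comp (G.stepSet A) (e, false, s) ≠
          (pairGraph (Corner E)).comp (G.stepSet A) (e, true, s') := fun s s' h' =>
        h (pairGraph.apply_eq_of_comp_eq (fun x : Corner E => G.graph.comp A (G.att x.1 x.2.1))
          (fun p hp => G.comp_att_of_boundaryStep hp) h')
      have hpair := G.corners_paired A e (fun _ _ => rfl)
      rcases hpair with ⟨h3, -⟩ | ⟨h3, -⟩ | ⟨h3, -⟩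
      · have h2 := (G.f_insert_le_of_comp_eq he (pairGraph.comp_mono hsub h3)).2 (hne _ _)
        omega
      · exact (hne _ _ (pairGraph.comp_mono (G.stepSetOff_subset A e) h3)).elim
      · exact (hne _ _ (pairGraph.comp_mono (G.stepSetOff_subset A e) h3)).elim

/-- In the interface graph, the number of vertices minus the number of components is at most the
number of edges, which is `f A`. -/
lemma c_add_c_dual_le (A : Set E) :
    G.graph.c A + G.dual.graph.c Aᶜ ≤ G.f A + G.graph.c Set.univ := by
  have h1 := (G.interfaceGraph A).r_eq Set.univ
  have h2 := Multigraph.r_le_ncard (H := G.interfaceGraph A) Set.univ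
  have h3 := G.interfaceGraph_c_le A
  rw [Nat.card_sum] at h1
  rw [Set.ncard_univ] at h2
  change _ = G.graph.c A + G.dual.graph.c Aᶜ at h1
  change _ ≤ G.f A at h2
  omega

/-- The interface inequality at `A = ∅`, where c and f both equal |V|, gives at most one dual
component; a boundary component exists because `G` has a vertex. -/
lemma Connected.dual {G : RibbonGraph V E} (hG : G.Connected) : G.dual.Connected := by
  have h1 := G.c_add_c_dual_le ∅
  rw [c_empty, f_empty, Set.compl_empty] at h1
  have h2 : 0 < G.graph.c Set.univ := by
    rw [hG]
    exact one_pos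
  obtain ⟨⟨⟨u⟩⟩, -⟩ := Nat.card_pos_iff.1 h2
  have hb : Nonempty (G.BoundaryComponent Set.univ) := by
    by_cases h : ∀ e i, G.att e i ≠ u
    · exact ⟨Sum.inr ⟨u, h⟩⟩
    · push Not at h
      obtain ⟨e, i, -⟩ := h
      exact ⟨G.face (e, i, false)⟩
  have h3 : 0 < G.dual.graph.c Set.univ :=
    Nat.card_pos_iff.2 ⟨hb.map (Quot.mk _), inferInstance⟩
  rw [hG] at h1
  unfold Connected
  omega

end RibbonGraph

/-! ### Parity of the Euler genus in the orientable case -/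

namespace RibbonGraph

variable {V E : Type*} (G : RibbonGraph V E)

lemma mate_color {o : Corner E → Bool} (ho : ∀ x : Corner E, o x.acrossEnd = !(o x) ∧
    o x.alongSide = !(o x)) (A : Set E) (x : Corner E) : o (mate A x) = !(o x) := by
  by_cases h : x.1 ∈ A
  · rw [mate_of_mem h, (ho x).2]
  · rw [mate_of_notMem h, (ho x).1]

/-- The corners of one colour of an orientation, permuted by walking along the boundary. -/
def boundaryPerm {o : Corner E → Bool} (hn : ∀ x, o (G.next x) = !(o x))
    (hm : ∀ A x, o (mate A x) = !(o x)) (A : Set E) : Equiv.Perm {x : Corner E // o x = true} where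
  toFun x := ⟨G.next (mate A x), by simp [hn, hm, x.2]⟩
  invFun x := ⟨mate A (G.next x), by simp [hn, hm, x.2]⟩
  left_inv x := by simp [G.next_next, mate_mate]
  right_inv x := by simp [G.next_next, mate_mate]

lemma sameCycle_boundaryPerm {o : Corner E → Bool} (hn : ∀ x, o (G.next x) = !(o x))
    (hm : ∀ A x, o (mate A x) = !(o x)) (A : Set E) {x y : {x : Corner E // o x = true}}
    (h : y.1 = G.next (mate A x.1)) : (G.boundaryPerm hn hm A).SameCycle x y := by
  have : y = G.boundaryPerm hn hm A x := Subtype.ext h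
  rw [this]
  exact Equiv.Perm.SameCycle.rfl.apply_right

/-- The orbits of the boundary walk on the corners of one colour are the boundary components
through corners. -/
lemma card_orbits_boundaryPerm {o : Corner E → Bool} (hn : ∀ x, o (G.next x) = !(o x))
    (hm : ∀ A x, o (mate A x) = !(o x)) (A : Set E) :
    Nat.card (Quot (G.boundaryPerm hn hm A).SameCycle) = Nat.card (Quot (G.BoundaryStep A)) := by
  have hstep : ∀ x : Corner E,
      (Quot.mk (G.BoundaryStep A) x : Quot (G.BoundaryStep A)) = Quot.mk _ (G.next (mate A x)) :=
    fun x => (Quot.sound (show G.BoundaryStep A x (mate A x) from Or.inr rfl)).trans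
      (Quot.sound (Or.inl rfl))
  let F : Quot (G.boundaryPerm hn hm A).SameCycle → Quot (G.BoundaryStep A) :=
    Quot.lift (fun x => Quot.mk _ x.1) (by
      rintro x y ⟨k, rfl⟩
      induction k using Int.induction_on with
      | zero => rfl
      | succ k ih =>
        rw [add_comm, zpow_add, zpow_one, Equiv.Perm.mul_apply]
        exact ih.trans (hstep _)
      | pred k ih =>
        rw [ih]
        have h := hstep ((G.boundaryPerm hn hm A ^ (-(k : ℤ) - 1)) x)
        refine Eq.trans ?_ h.symm
        change _ = Quot.mk _ (G.boundaryPerm hn hm A ((G.boundaryPerm hn hm A ^ (-(k : ℤ) - 1)) x)).1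
        rw [← Equiv.Perm.mul_apply, ← zpow_one_add]
        congr 4
        ring)
  -- A corner of the other colour is first moved along its free arc, which reverses the colour but
  -- stays on the boundary component.
  let F' : Quot (G.BoundaryStep A) → Quot (G.boundaryPerm hn hm A).SameCycle :=
    Quot.lift (fun x => if h : o x = true then Quot.mk _ ⟨x, h⟩
      else Quot.mk _ ⟨G.next x, by simp [hn, h]⟩) (by
      intro x y hxy
      by_cases hx : o x = true
      · have hy : ¬ o y = true := by
          rcases G.boundaryStep_iff.1 hxy with rfl | rfl
          · simp [hn, hx]
          · simp [hm, hx]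
        simp only [hx, hy, dite_true]
        rcases G.boundaryStep_iff.1 hxy with rfl | rfl
        · simp [G.next_next]
        · exact Quot.sound (G.sameCycle_boundaryPerm hn hm A rfl)
      · have hy : o y = true := by
          rcases G.boundaryStep_iff.1 hxy with rfl | rfl
          · simp [hn, hx]
          · simp [hm, hx]
        simp only [hx, hy, dite_true]
        rcases G.boundaryStep_iff.1 hxy with rfl | rfl
        · rfl
        · refine (Quot.sound (G.sameCycle_boundaryPerm hn hm A ?_)).symm
          simp [mate_mate])
  refine Nat.card_congr ⟨F, F', ?_, ?_⟩
  · rintro ⟨x⟩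
    exact dif_pos x.2
  · rintro ⟨x⟩
    by_cases hx : o x = true
    · exact congrArg F (dif_pos hx)
    · refine (congrArg F (dif_neg hx)).trans ?_
      exact (Quot.sound (show G.BoundaryStep A x (G.next x) from Or.inl rfl)).symm

-- Exactly two corners `p`, `q` of `e` have the chosen colour, and they are diagonally opposite. The
-- side from one leads to the same corner as the end from the other, so inserting `e` precomposes
-- with the transposition of `p` and `q`.
open Classical in
lemma sign_boundaryPerm_insert {o : Corner E → Bool} [Fintype {x : Corner E // o x = true}]
    (hn : ∀ x, o (G.next x) = !(o x)) (hm : ∀ A x, o (mate A x) = !(o x))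
    {A : Set E} {e : E} (he : e ∉ A) :
    Equiv.Perm.sign (G.boundaryPerm hn hm (insert e A)) =
      -Equiv.Perm.sign (G.boundaryPerm hn hm A) := by
  have hmem : e ∈ insert e A := Set.mem_insert e A
  have h1 : ∀ i s, o (e, i, !s) = !(o (e, i, s)) := fun i s => by
    simpa [mate_of_notMem (x := (e, i, s)) he, Corner.acrossEnd] using hm A (e, i, s)
  have h2 : ∀ i s, o (e, !i, s) = !(o (e, i, s)) := fun i s => by
    simpa [mate_of_mem (x := (e, i, s)) hmem, Corner.alongSide] using hm (insert e A) (e, i, s)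
  obtain ⟨s, hs⟩ : ∃ s, o (e, false, s) = true := by
    by_cases h : o (e, false, false) = true
    · exact ⟨_, h⟩
    · exact ⟨true, by simpa [h] using h1 false false⟩
  have hs' : o (e, true, !s) = true := by
    rw [h1, show o (e, true, s) = !(o (e, false, s)) from h2 false s, hs]
    rfl
  set p : {x : Corner E // o x = true} := ⟨(e, false, s), hs⟩ with hp
  set q : {x : Corner E // o x = true} := ⟨(e, true, !s), hs'⟩ with hq
  have hpq : p ≠ q := by simp [hp, hq]
  have h : G.boundaryPerm hn hm (insert e A) = G.boundaryPerm hn hm A * Equiv.swap p q := by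
    ext1 x
    rw [Equiv.Perm.mul_apply]
    apply Subtype.ext
    change G.next (mate (insert e A) x.1) = G.next (mate A (Equiv.swap p q x).1)
    congr 1
    by_cases hx : x.1.1 = e
    · have hx' : x = p ∨ x = q := by
        obtain ⟨⟨e', i, s'⟩, hxo⟩ := x
        obtain rfl : e' = e := hx
        have h3 : o (e', false, !s) = false := by rw [h1, hs, Bool.not_true]
        have h4 : o (e', true, s) = false := (h2 false s).trans (by rw [hs, Bool.not_true])
        rcases eq_or_ne s' s with rfl | hs's
        · cases i
          · exact Or.inl rfl
          · simp [h4] at hxo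
        · obtain rfl := Bool.eq_not_of_ne hs's
          cases i
          · simp [h3] at hxo
          · exact Or.inr rfl
      rw [mate_of_mem (by rw [hx]; exact hmem)]
      rcases hx' with rfl | rfl
      · rw [Equiv.swap_apply_left, mate_of_notMem (by exact he)]
        simp [hp, hq, Corner.alongSide, Corner.acrossEnd]
      · rw [Equiv.swap_apply_right, mate_of_notMem (by exact he)]
        simp [hp, hq, Corner.alongSide, Corner.acrossEnd]
    · rw [Equiv.swap_apply_of_ne_of_ne (by rintro rfl; exact hx rfl) (by rintro rfl; exact hx rfl)]
      by_cases h : x.1.1 ∈ A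
      · rw [mate_of_mem h, mate_of_mem (Set.mem_insert_of_mem _ h)]
      · rw [mate_of_notMem h, mate_of_notMem (by simp [hx, h])]
  rw [h, Equiv.Perm.sign_mul, Equiv.Perm.sign_swap hpq, mul_neg_one]

/-- The Euler genus of a spanning ribbon subgraph of an orientable ribbon graph is even. -/
lemma Orientable.even {G : RibbonGraph V E} [Finite V] [Finite E] (hG : G.Orientable) (A : Set E) :
    Even (G.f A + Nat.card V + A.ncard) := by
  classical
  obtain ⟨o, ho⟩ := hG
  have hn : ∀ x, o (G.next x) = !(o x) := fun x => (ho x).1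
  have hm := mate_color fun x => (ho x).2
  have := Fintype.ofFinite {x : Corner E // o x = true}
  induction A, A.toFinite using Set.Finite.induction_on with
  | empty => simp [f_empty]
  | @insert e A he _ ih =>
    rw [Set.ncard_insert_of_notMem he]
    have h1 := G.sign_boundaryPerm_insert hn hm he
    rw [Equiv.Perm.sign_eq_neg_one_pow_card_orbits, Equiv.Perm.sign_eq_neg_one_pow_card_orbits,
      card_orbits_boundaryPerm, card_orbits_boundaryPerm] at h1
    -- Edgeless vertex discs contribute the same amount for every `A`, so the parity of `f` changes
    -- with that of the number of orbits.
    have h2 : ∀ A, G.f A = Nat.card (Quot (G.BoundaryStep A)) +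
        Nat.card {v : V // ∀ e i, G.att e i ≠ v} := fun A => by rw [f, Nat.card_sum]
    rw [h2] at ih ⊢
    have h3 : ∀ m n : ℕ, (-1 : ℤˣ) ^ m = -(-1) ^ n → (Even m ↔ ¬ Even n) := by
      intro m n hmn
      rcases Nat.even_or_odd m with h | h <;> rcases Nat.even_or_odd n with h' | h' <;>
        simp_all
    have h4 := h3 _ _ h1
    simp only [Nat.even_add, Nat.not_even_one] at h4 ih ⊢
    tauto

end RibbonGraph

/-! ### Exponents after substitution -/

lemma evalXY_monomial (m n : ℕ) :
    evalXY ((MvPolynomial.X 0 - 1) ^ m * (MvPolynomial.X 1 - 1) ^ n) =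
      LaurentPolynomial.T ((m : ℤ) + n) := by
  simp only [evalXY, map_mul, map_pow, map_sub, map_one, MvPolynomial.aeval_X, Matrix.cons_val,
    add_sub_cancel_right, LaurentPolynomial.T_pow, LaurentPolynomial.T_add, mul_one]

lemma evalXYZ_monomial (m n k : ℕ) :
    evalXYZ ((MvPolynomial.X 0 - 1) ^ m * MvPolynomial.X 1 ^ n * MvPolynomial.X 2 ^ k) =
      LaurentPolynomial.T ((m : ℤ) + n - k) := by
  simp only [evalXYZ, map_mul, map_pow, map_sub, map_one, MvPolynomial.aeval_X, Matrix.cons_val,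
    add_sub_cancel_right, LaurentPolynomial.T_pow, LaurentPolynomial.T_add, mul_one, mul_neg,
    sub_eq_add_neg (_ + _ : ℤ)]

namespace RibbonGraph

variable {V E : Type*} {G : RibbonGraph V E}

/-- The exponent of `z` in the term of the Las Vergnas polynomial that belongs to `A`. -/
def lasVergnasDegree [Finite V] [Finite E] (G : RibbonGraph V E) (A : Set E) : ℕ :=
  (G.dual.graph.bondMatroid.natRk Set.univ - G.dual.graph.bondMatroid.natRk A) -
    (G.graph.cycleMatroid.natRk Set.univ - G.graph.cycleMatroid.natRk A)

/-- The exponents in the Tutte polynomial of the perspective `B(G*) → C(G)`. -/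
lemma lasVergnas_exponents [Finite V] [Finite E] (hG : G.Connected) (A : Set E) :
    G.graph.cycleMatroid.natRk Set.univ - G.graph.cycleMatroid.natRk A + 1 = G.graph.c A ∧
    A.ncard - G.dual.graph.bondMatroid.natRk A + 1 = G.dual.graph.c Aᶜ ∧
    G.lasVergnasDegree A + G.graph.c A + A.ncard + G.f Set.univ =
      Nat.card E + G.dual.graph.c Aᶜ + 1 := by
  have hd := hG.dual
  have h1 := G.dual.graph.natRk_bondMatroid A
  have h2 := G.dual.graph.natRk_bondMatroid Set.univ
  have h3 := G.dual.graph.r_eq Set.univ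
  have h4 := G.dual.graph.r_eq Aᶜ
  have h5 := G.graph.r_eq Set.univ
  have h6 := G.graph.r_eq A
  have h7 := c_pos hG A
  have h8 := c_pos hd Aᶜ
  have h9 : Nat.card (G.BoundaryComponent Set.univ) = G.f Set.univ := rfl
  have h10 := G.graph.natRk_cycleMatroid A
  have h11 := G.graph.natRk_cycleMatroid Set.univ
  -- The exponent of z is γ*(Aᶜ) + k; `h12` and `h13` say that both summands are nonnegative, so its
  -- subtraction is not truncated.
  have h12 := G.c_add_c_dual_le A
  have h13 := G.dual.f_add_card_le Aᶜ
  have h14 := Set.ncard_add_ncard_compl A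
  have h15 := Multigraph.r_union_le (H := G.dual.graph) Aᶜ A
  rw [Set.compl_union_self] at h15
  rw [f_dual_compl] at h13
  rw [Set.compl_univ, Multigraph.r_empty, Set.ncard_univ] at h2
  unfold Connected at hG hd
  unfold lasVergnasDegree
  refine ⟨?_, ?_, ?_⟩ <;> omega

/-- The exponents in the Bollobás-Riordan polynomial. -/
lemma bollobasRiordan_exponents [Finite V] [Finite E] (hG : G.Connected) (A : Set E) :
    G.graph.r Set.univ - G.graph.r A + 1 = G.graph.c A ∧
    G.graph.n A + Nat.card V = A.ncard + G.graph.c A ∧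
    G.graph.c A + G.graph.n A - G.f A + G.f A + Nat.card V = A.ncard + 2 * G.graph.c A := by
  have h1 := G.graph.r_eq Set.univ
  have h2 := G.graph.r_eq A
  have h3 := Multigraph.r_le_ncard (H := G.graph) A
  have h4 := c_pos hG A
  have h5 := G.f_add_card_le A
  unfold Connected at hG
  unfold Multigraph.n
  refine ⟨?_, ?_, ?_⟩ <;> omega

lemma evalXYZ_bollobasRiordan [Finite V] [Fintype E] (hG : G.Connected) :
    evalXYZ G.bollobasRiordan = ∑ A : Finset E, LaurentPolynomial.T ((G.f A : ℤ) - 1) := by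
  have h : evalXYZ G.bollobasRiordan = ∑ A : Finset E, evalXYZ
      ((MvPolynomial.X 0 - 1) ^ (G.graph.r Set.univ - G.graph.r A)
        * MvPolynomial.X 1 ^ G.graph.n A
        * MvPolynomial.X 2 ^ (G.graph.c A + G.graph.n A - G.f A)) := by
    simp only [evalXYZ, bollobasRiordan, map_sum]
  rw [h]
  refine Finset.sum_congr rfl fun A _ => ?_
  rw [evalXYZ_monomial]
  obtain ⟨h1, h2, h3⟩ := bollobasRiordan_exponents hG A
  congr 1
  omega

lemma evalXY_lasVergnas_term [Finite V] [Fintype E] (hG : G.Connected) (A : Finset E) :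
    evalXY ((MvPolynomial.X 0 - 1) ^
          (G.graph.cycleMatroid.natRk Set.univ - G.graph.cycleMatroid.natRk A)
        * (MvPolynomial.X 1 - 1) ^ (A.card - G.dual.graph.bondMatroid.natRk A)) =
      LaurentPolynomial.T ((G.graph.c A : ℤ) + G.dual.graph.c (A : Set E)ᶜ - 2) := by
  rw [evalXY_monomial]
  obtain ⟨h1, h2, -⟩ := lasVergnas_exponents hG A
  rw [Set.ncard_coe_finset] at h2
  congr 1
  omega

lemma evalXY_eval_lasVergnas [Finite V] [Fintype E] (hG : G.Connected) :
    evalXY (G.lasVergnas.eval 1) = ∑ A : Finset E,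
      LaurentPolynomial.T ((G.graph.c A : ℤ) + G.dual.graph.c (A : Set E)ᶜ - 2) := by
  simp only [← evalXY_lasVergnas_term hG, lasVergnas, perspectiveTutte,
    Polynomial.eval_finsetSum, Polynomial.eval_mul, Polynomial.eval_C, Polynomial.eval_pow,
    Polynomial.eval_X, one_pow, mul_one]
  exact map_sum (MvPolynomial.aeval _) _ _

lemma evalXY_coeff_lasVergnas [Finite V] [Fintype E] (hG : G.Connected) (k : ℕ) :
    evalXY (G.lasVergnas.coeff k) = ∑ A : Finset E,
      if k = G.lasVergnasDegree A then
        LaurentPolynomial.T ((G.graph.c A : ℤ) + G.dual.graph.c (A : Set E)ᶜ - 2) else 0 := by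
  simp only [← evalXY_lasVergnas_term hG, lasVergnas, perspectiveTutte,
    Polynomial.finsetSum_coeff, Polynomial.coeff_C_mul, Polynomial.coeff_X_pow, mul_ite, mul_one,
    mul_zero]
  refine (map_sum (MvPolynomial.aeval _) _ _).trans (Finset.sum_congr rfl fun A _ => ?_)
  rw [apply_ite (MvPolynomial.aeval _), map_zero]
  rfl

/-! ### Comparison of the exponents in low genus -/

/-- In Euler genus at most one, the boundary components of a spanning ribbon subgraph are determined
by the components of the subgraph and of its dual complement. -/
lemma f_add_one_of_eulerGenus_le_one [Finite V] [Finite E] (hG : G.Connected)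
    (hg : G.eulerGenus ≤ 1) (A : Set E) :
    G.f A + 1 = G.graph.c A + G.dual.graph.c Aᶜ := by
  -- Adding `h1` and the dual inequality `h2` gives 2k ≤ γ(G) ≤ 1, while `h3` gives k ≥ 0.
  have h1 := G.f_add_card_le A
  have h2 := G.dual.f_add_card_le Aᶜ
  have h3 := G.c_add_c_dual_le A
  have h4 := Set.ncard_add_ncard_compl A
  have h5 : Nat.card (G.BoundaryComponent Set.univ) = G.f Set.univ := rfl
  rw [f_dual_compl] at h2
  unfold Connected at hG
  unfold eulerGenus at hg
  omega

/-- On the torus, the degree of a term of the Las Vergnas polynomial determines the number of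
boundary components of the spanning ribbon subgraph. -/
lemma IsTorus.lasVergnasDegree_cases [Finite V] [Finite E] (hG : G.IsTorus) (A : Set E) :
    G.lasVergnasDegree A = 1 ∧ G.f A = G.graph.c A + G.dual.graph.c Aᶜ ∨
    (G.lasVergnasDegree A = 0 ∨ G.lasVergnasDegree A = 2) ∧
      G.f A + 1 = G.graph.c A + G.dual.graph.c Aᶜ := by
  obtain ⟨hc, ho, hg⟩ := hG
  have h0 := (lasVergnas_exponents hc A).2.2
  have h1 := G.f_add_card_le A
  have h2 := G.dual.f_add_card_le Aᶜ
  have h3 := G.c_add_c_dual_le A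
  have h4 := Set.ncard_add_ncard_compl A
  have h5 : Nat.card (G.BoundaryComponent Set.univ) = G.f Set.univ := rfl
  -- Parity excludes γ(A) = γ*(Aᶜ) = 1, where the degree would be 1 although the defect is 0.
  obtain ⟨k, h6⟩ := ho.even A
  rw [f_dual_compl] at h2
  unfold Connected at hc
  unfold eulerGenus at hg
  omega

end RibbonGraph

end

theorem theorem6p9 {V E : Type*} [Finite V] [Fintype E] (G : RibbonGraph V E) :
    (G.IsPlane ∨ G.IsProjectivePlane →
      evalXY (G.lasVergnas.eval 1) = evalXYZ G.bollobasRiordan) ∧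
    (G.IsTorus →
      evalXY (G.lasVergnas.coeff 2)
          + LaurentPolynomial.T 1 * evalXY (G.lasVergnas.coeff 1)
          + evalXY (G.lasVergnas.coeff 0)
        = evalXYZ G.bollobasRiordan) := by
  constructor
  · intro h
    have hc : G.Connected := h.elim And.left And.left
    have hg : G.eulerGenus ≤ 1 := by
      rcases h with h | h <;> rw [h.2]
      exact zero_le_one
    rw [RibbonGraph.evalXY_eval_lasVergnas hc, RibbonGraph.evalXYZ_bollobasRiordan hc]
    refine Finset.sum_congr rfl fun A _ => ?_
    have h1 := RibbonGraph.f_add_one_of_eulerGenus_le_one hc hg A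
    congr 1
    omega
  · intro h
    rw [RibbonGraph.evalXYZ_bollobasRiordan h.1]
    simp only [RibbonGraph.evalXY_coeff_lasVergnas h.1]
    rw [Finset.mul_sum, ← Finset.sum_add_distrib, ← Finset.sum_add_distrib]
    refine Finset.sum_congr rfl fun A _ => ?_
    -- Exactly one of the three coefficients receives the term of `A`; in degree 1 the factor `T 1`
    -- raises the exponent c(A) + c*(Aᶜ) - 2 to f(A) - 1.
    rcases h.lasVergnasDegree_cases A with ⟨h1, h2⟩ | ⟨h1 | h1, h2⟩
    · simp only [h1, OfNat.ofNat_ne_one, zero_ne_one, if_true, if_false, zero_add, add_zero,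
        ← LaurentPolynomial.T_add]
      congr 1
      omega
    · simp only [h1, OfNat.ofNat_ne_zero, one_ne_zero, if_true, if_false, zero_add, mul_zero]
      congr 1
      omega
    · simp only [h1, OfNat.one_ne_ofNat, OfNat.zero_ne_ofNat, if_true, if_false, add_zero,
        mul_zero]
      congr 1
      omega
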